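/- **Theorem (SoS Matrix Bernstein).** Let $d\ge 1$ and $r,k\ge 0$ be integers and let $R,\sigma\ge 0$ be real numbers. For $u\in\mathbb R^d$ let $u^{\otimes r}\in\mathbb R^{d^r}$ be the vector with entries $\prod_{j=1}^r u_{\alpha_j}$, indexed by $\alpha\in\{1,\dots,d\}^r$. For polynomials $p,q$ in $u=(u_1,\dots,u_d)$ with real coefficients, write $p\preceq q$ if $q-p$ is a finite sum of squares of real polynomials. A *degree-$2r$ pseudoexpectation satisfying $\|u\|^2=1$* is a linear functional $\tilde{\mathbb E}$ on the real polynomials in $u$ of degree at most $2r$ such that $\tilde{\mathbb E}[1]=1$, $\tilde{\mathbb E}[p^2]\ge 0$ whenever $\deg (p^2)\le 2r$, and $\tilde{\mathbb E}[(\|u\|^2-1)q]=0$ whenever $\deg((\|u\|^2-1)q)\le 2r$. Let $M_1,\dots,M_k$ be i.i.d., mean-zero, symmetric random matrices in $\mathbb R^{d^r\times d^r}$ such that, for every $i$, - $\|M_i\|\le R$ almost surely, where $\|\cdot\|$ is the spectral norm, and - $\mathbb E\,\langle u^{\otimes r}, M_i^2\,u^{\otimes r}\rangle\preceq \sigma^2\|u\|^{2r}$,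 where both sides are polynomials in $u$. Then the maximum $$\max_{\tilde{\mathbb E}}\ \tilde{\mathbb E}\Big[\sum_{i\le k}\langle u^{\otimes r}, M_i\,u^{\otimes r}\rangle\Big]$$ over all degree-$2r$ pseudoexpectations satisfying $\|u\|^2=1$ is always attained, it is an integrable random variable, and $$\mathbb E\Big[\max_{\tilde{\mathbb E}}\ \tilde{\mathbb E}\Big[\sum_{i\le k}\langle u^{\otimes r}, M_i\,u^{\otimes r}\rangle\Big]\Big]\ \le\ \frac{2(\log 2+r\log d)}{3}\,R+2\sqrt{2k(\log 2+r\log d)}\;\sigma ,$$ where $\log$ is the natural logarithm. -/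

import Mathlib

/-- The product (entrywise) Borel σ-algebra on real matrices. -/
instance matrixMeasurableSpace {m n : Type*} : MeasurableSpace (Matrix m n ℝ) :=
  inferInstanceAs (MeasurableSpace (m → n → ℝ))

/-- The tensor power `u^{⊗ r}` of a vector `u`, indexed by the `d ^ r` multi-indices
`Fin r → Fin d`: its `α`-th entry is `u (α 0) * ⋯ * u (α (r - 1))`. -/
def tensorPow {A : Type*} [CommSemiring A] {d : ℕ} (r : ℕ) (u : Fin d → A) :
    (Fin r → Fin d) → A :=
  fun α => ∏ j, u (α j)

/-- The polynomial `⟨u^{⊗ r}, M u^{⊗ r}⟩` in the variables `u = (u_1, …, u_d)`. -/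
noncomputable def tensorFormPoly {d r : ℕ}
    (M : Matrix (Fin r → Fin d) (Fin r → Fin d) ℝ) : MvPolynomial (Fin d) ℝ :=
  tensorPow r MvPolynomial.X ⬝ᵥ
    (Matrix.mulVec (M.map MvPolynomial.C) (tensorPow r MvPolynomial.X))

theorem tensorPow_X_totalDegree_le {d r : ℕ} (α : Fin r → Fin d) :
    (tensorPow r (MvPolynomial.X : Fin d → MvPolynomial (Fin d) ℝ) α).totalDegree ≤ r := by
  unfold tensorPow
  refine (MvPolynomial.totalDegree_finsetProd _ _).trans ?_
  simp [MvPolynomial.totalDegree_X]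

theorem tensorFormPoly_mem {d r : ℕ} (M : Matrix (Fin r → Fin d) (Fin r → Fin d) ℝ) :
    tensorFormPoly M ∈ MvPolynomial.restrictTotalDegree (Fin d) ℝ (2 * r) := by
  unfold tensorFormPoly dotProduct Matrix.mulVec dotProduct
  refine Submodule.sum_mem _ fun α _ => ?_
  rw [Finset.mul_sum]
  refine Submodule.sum_mem _ fun β _ => ?_
  rw [MvPolynomial.mem_restrictTotalDegree]
  have h1 := MvPolynomial.totalDegree_mul
    (tensorPow r (MvPolynomial.X : Fin d → MvPolynomial (Fin d) ℝ) α)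
    (M.map MvPolynomial.C α β * tensorPow r MvPolynomial.X β)
  have h2 := MvPolynomial.totalDegree_mul
    (M.map (MvPolynomial.C (σ := Fin d)) α β) (tensorPow r MvPolynomial.X β)
  have h3 : (M.map (MvPolynomial.C (σ := Fin d)) α β).totalDegree = 0 := by
    simp [Matrix.map_apply]
  have h4 := tensorPow_X_totalDegree_le α
  have h5 := tensorPow_X_totalDegree_le β
  exact h1.trans (by omega)

/-- The polynomial `⟨u^{⊗ r}, M u^{⊗ r}⟩`, as an element of the space of polynomials of total
degree at most `2 * r`. -/
noncomputable def tensorForm {d r : ℕ} (M : Matrix (Fin r → Fin d) (Fin r → Fin d) ℝ) :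
    MvPolynomial.restrictTotalDegree (Fin d) ℝ (2 * r) :=
  ⟨tensorFormPoly M, tensorFormPoly_mem M⟩

/-- `p ⪯ q` for real polynomial functions `p`, `q` of `u ∈ ℝ^d`: the difference `q - p` is (the
function of) a finite sum of squares of polynomials. Over `ℝ` a polynomial is determined by its
function. -/
def SosLE {d : ℕ} (p q : (Fin d → ℝ) → ℝ) : Prop :=
  ∃ s : MvPolynomial (Fin d) ℝ, IsSumSq s ∧ ∀ u, q u - p u = MvPolynomial.eval u s

/-- A linear functional `E` on the real polynomials of total degree at most `ℓ` in
`u_1, …, u_d` is a degree-`ℓ` pseudoexpectation satisfying `‖u‖² = 1`. -/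
structure IsSpherePseudoexpectation {d ℓ : ℕ}
    (E : MvPolynomial.restrictTotalDegree (Fin d) ℝ ℓ →ₗ[ℝ] ℝ) : Prop where
  /-- `E 1 = 1`. -/
  map_one : ∀ h : (1 : MvPolynomial (Fin d) ℝ) ∈ MvPolynomial.restrictTotalDegree (Fin d) ℝ ℓ,
    E ⟨1, h⟩ = 1
  /-- `E (p ^ 2) ≥ 0` whenever `p ^ 2` has degree at most `ℓ`. -/
  map_sq_nonneg : ∀ (p : MvPolynomial (Fin d) ℝ)
    (h : p ^ 2 ∈ MvPolynomial.restrictTotalDegree (Fin d) ℝ ℓ), 0 ≤ E ⟨p ^ 2, h⟩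
  /-- `E ((‖u‖² - 1) q) = 0` whenever `(‖u‖² - 1) q` has degree at most `ℓ`. -/
  map_sphere : ∀ (q : MvPolynomial (Fin d) ℝ)
    (h : (∑ j, MvPolynomial.X j ^ 2 - 1) * q ∈ MvPolynomial.restrictTotalDegree (Fin d) ℝ ℓ),
    E ⟨(∑ j, MvPolynomial.X j ^ 2 - 1) * q, h⟩ = 0

/-- The values `E p` of the degree-`ℓ` pseudoexpectations `E` satisfying `‖u‖² = 1`. -/
def sosValues {d ℓ : ℕ} (p : MvPolynomial.restrictTotalDegree (Fin d) ℝ ℓ) : Set ℝ :=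
  {x | ∃ E : MvPolynomial.restrictTotalDegree (Fin d) ℝ ℓ →ₗ[ℝ] ℝ,
    IsSpherePseudoexpectation E ∧ E p = x}

/-- The maximum of `E p` over the degree-`ℓ` pseudoexpectations `E` satisfying `‖u‖² = 1`. -/
noncomputable def sosMax {d ℓ : ℕ} (p : MvPolynomial.restrictTotalDegree (Fin d) ℝ ℓ) : ℝ :=
  sSup (sosValues p)

/-! A degree-2r pseudoexpectation Ẽ is nonnegative on ⟨u^{⊗r}, A u^{⊗r}⟩ for A positive
semidefinite, since this form is a sum of squares. Hence Ẽ of any symmetric form is at most the top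
eigenvalue of A, and so at most log tr exp A.

The variance hypothesis controls V = Σ E M_i² only as a polynomial, not in spectral norm, so the
usual matrix Bernstein inequality for S = Σ M_i is not available. Instead V is kept in the exponent:
writing Ẽ[A] for Ẽ of the form of A, η Ẽ[S] ≤ log tr exp(ηS − η²V) + η² Ẽ[V], and Ẽ[V] ≤ kσ² is
exactly what the hypothesis gives.

It remains to see that E tr exp(ηS − η²V) ≤ N = d^r when ηR ≤ 3/2
(`integral_trace_exp_compensated_le`). Golden–Thompson (`trace_exp_add_le`) and exp X ⪯ 1 + X + X²
split off one summand; averaging turns it into 1 + W with W = η² E M_i²; convexity, tr exp(B)(1 + W)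
≤ tr exp(B + W), cancels the compensator −W. Consequently E max Ẽ[S] ≤ (log N)/η + kσ²η, and η is
then chosen. The maximum is attained by compactness, and it is continuous in S, hence measurable. -/

section
open Matrix

/-! ### Trace inequalities for powers of products -/

section Trace

variable {n : Type*} [Fintype n]

theorem two_mul_trace_mul_transpose_le (A B : Matrix n n ℝ) :
    2 * (A * Bᵀ).trace ≤ (A * Aᵀ).trace + (B * Bᵀ).trace := by
  have h : ∀ C D : Matrix n n ℝ, (C * Dᵀ).trace = ∑ i, ∑ j, C i j * D i j := fun C D => by
    simp [Matrix.trace, Matrix.mul_apply]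
  rw [h, h, h, Finset.mul_sum, ← Finset.sum_add_distrib]
  refine Finset.sum_le_sum fun i _ => ?_
  rw [Finset.mul_sum, ← Finset.sum_add_distrib]
  exact Finset.sum_le_sum fun j _ => by nlinarith [sq_nonneg (A i j - B i j)]

variable [DecidableEq n]

theorem trace_mul_pow_comm (A B : Matrix n n ℝ) (m : ℕ) :
    ((A * B) ^ m).trace = ((B * A) ^ m).trace := by
  cases m with
  | zero => simp
  | succ m =>
    have h : (A * B) ^ (m + 1) = A * ((B * A) ^ m * B) := by
      induction m with
      | zero => simp
      | succ m ih => rw [pow_succ', ih, pow_succ' (B * A)]; simp only [mul_assoc]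
    rw [h, Matrix.trace_mul_comm, mul_assoc, ← pow_succ]

/-- The two claims are proved jointly because each feeds the other. For Z, apply the first claim to
Z², rotate cyclically to (ZZᵀ · ZᵀZ)^(2^j), separate the factors by the second claim, and finish
with AM-GM, as ZZᵀ and ZᵀZ have equal power traces. For P, Q, apply the first claim to PQ, rotate to
P²Q², and use the second. -/
theorem trace_pow_two_pow_le (j : ℕ) :
    (∀ Z : Matrix n n ℝ, (Z ^ 2 ^ (j + 1)).trace ≤ ((Z * Zᵀ) ^ 2 ^ j).trace) ∧
      ∀ P Q : Matrix n n ℝ, P.IsSymm → Q.IsSymm →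
        ((P * Q) ^ 2 ^ j).trace ≤ (P ^ 2 ^ j * Q ^ 2 ^ j).trace := by
  induction j with
  | zero =>
    refine ⟨fun Z => ?_, fun P Q _ _ => by simp⟩
    have h := two_mul_trace_mul_transpose_le Z Zᵀ
    rw [Matrix.transpose_transpose, Matrix.trace_mul_comm Zᵀ Z] at h
    simp only [zero_add, pow_one, pow_zero, sq]
    linarith
  | succ j ih =>
    obtain ⟨hS, hC⟩ := ih
    constructor
    · intro Z
      have hP : (Zᵀ * Z).IsSymm := Matrix.isSymm_transpose_mul_self Z
      have hQ : (Z * Zᵀ).IsSymm := Matrix.isSymm_mul_transpose_self Z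
      have h1 := hS (Z ^ 2)
      rw [← pow_mul, ← pow_succ'] at h1
      have h2 : ((Z ^ 2 * (Z ^ 2)ᵀ) ^ 2 ^ j).trace
          = (((Z * Zᵀ) * (Zᵀ * Z)) ^ 2 ^ j).trace := by
        have : Z ^ 2 * (Z ^ 2)ᵀ = Z * (Z * Zᵀ * Zᵀ) := by
          rw [Matrix.transpose_pow]; simp only [sq, mul_assoc]
        rw [this, trace_mul_pow_comm]
        simp only [mul_assoc]
      have h3 := hC _ _ hQ hP
      have h4 := two_mul_trace_mul_transpose_le ((Z * Zᵀ) ^ 2 ^ j) ((Zᵀ * Z) ^ 2 ^ j)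
      rw [(hP.pow _).eq, (hQ.pow _).eq, ← pow_add, ← pow_add, ← two_mul, ← pow_succ',
        trace_mul_pow_comm Zᵀ Z] at h4
      linarith
    · intro P Q hP hQ
      have h1 := hS (P * Q)
      have h2 : ((P * Q * (P * Q)ᵀ) ^ 2 ^ j).trace = ((P ^ 2 * Q ^ 2) ^ 2 ^ j).trace := by
        rw [Matrix.transpose_mul, hP.eq, hQ.eq]
        have : P * Q * (Q * P) = (P * Q ^ 2) * P := by simp only [sq, mul_assoc]
        rw [this, trace_mul_pow_comm]
        simp only [sq, mul_assoc]
      have h3 := hC (P ^ 2) (Q ^ 2) (hP.pow 2) (hQ.pow 2)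
      rw [← pow_mul, ← pow_mul, ← pow_succ'] at h3
      linarith

end Trace
-- The Lie product formula
section Lie
open NormedSpace Filter Topology

variable {𝔸 : Type*} [NormedRing 𝔸]

theorem norm_pow_sub_pow_le [NormOneClass 𝔸] {U V : 𝔸} {c : ℝ} (hc : 1 ≤ c)
    (hU : ‖U‖ ≤ c) (hV : ‖V‖ ≤ c) (m : ℕ) :
    ‖U ^ m - V ^ m‖ ≤ m * c ^ m * ‖U - V‖ := by
  induction m with
  | zero => simp
  | succ m ih =>
    have hc0 : 0 ≤ c := zero_le_one.trans hc
    have h : U ^ (m + 1) - V ^ (m + 1) = (U ^ m - V ^ m) * U + V ^ m * (U - V) := by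
      rw [pow_succ, pow_succ]; noncomm_ring
    have hVm : ‖V ^ m‖ ≤ c ^ m := (norm_pow_le V m).trans (pow_le_pow_left₀ (norm_nonneg _) hV m)
    calc ‖U ^ (m + 1) - V ^ (m + 1)‖
        ≤ ‖U ^ m - V ^ m‖ * ‖U‖ + ‖V ^ m‖ * ‖U - V‖ := by
          rw [h]
          exact (norm_add_le _ _).trans (add_le_add (norm_mul_le _ _) (norm_mul_le _ _))
      _ ≤ (m * c ^ m * ‖U - V‖) * c + c ^ (m + 1) * ‖U - V‖ := by
          have : c ^ m ≤ c ^ (m + 1) := pow_le_pow_right₀ hc m.le_succ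
          gcongr
          exact hVm.trans this
      _ = (m + 1 : ℕ) * c ^ (m + 1) * ‖U - V‖ := by push_cast; ring

variable [NormOneClass 𝔸] [NormedAlgebra ℝ 𝔸]

theorem norm_exp_le_exp_norm (A : 𝔸) : ‖exp A‖ ≤ Real.exp ‖A‖ := by
  rw [exp_eq_tsum ℝ, Real.exp_eq_exp_ℝ, exp_eq_tsum ℝ]
  refine (norm_tsum_le_tsum_norm (norm_expSeries_summable' (𝕂 := ℝ) A)).trans ?_
  refine (norm_expSeries_summable' (𝕂 := ℝ) A).tsum_le_tsum (fun m => ?_)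
    (expSeries_summable' (𝕂 := ℝ) ‖A‖)
  rw [norm_smul, smul_eq_mul, Real.norm_of_nonneg (by positivity)]
  exact mul_le_mul_of_nonneg_left (norm_pow_le A m) (by positivity)

variable [CompleteSpace 𝔸]

/-- exp(tA) exp(tB) and exp(t(A + B)) agree to first order at t = 0, so at t = 1/m they differ by
o(1/m); taking m-th powers costs only a factor m times a constant. -/
theorem tendsto_exp_mul_exp_pow (A B : 𝔸) :
    Tendsto (fun m : ℕ => (exp ((m : ℝ)⁻¹ • A) * exp ((m : ℝ)⁻¹ • B)) ^ m) atTop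
      (𝓝 (exp (A + B))) := by
  let +nondep : NormedAlgebra ℚ 𝔸 := .restrictScalars ℚ ℝ 𝔸
  have hd : HasDerivAt (fun t : ℝ => exp (t • A) * exp (t • B) - exp (t • (A + B))) 0 0 := by
    have h := ((hasDerivAt_exp_smul_const (𝕂 := ℝ) A 0).mul
      (hasDerivAt_exp_smul_const (𝕂 := ℝ) B 0)).sub (hasDerivAt_exp_smul_const (𝕂 := ℝ) (A + B) 0)
    simp only [zero_smul, exp_zero, one_mul, mul_one, sub_self] at h
    exact h
  have hlim : Tendsto (fun m : ℕ => (m : ℝ) * ‖exp ((m : ℝ)⁻¹ • A) * exp ((m : ℝ)⁻¹ • B)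
      - exp ((m : ℝ)⁻¹ • (A + B))‖) atTop (𝓝 0) := by
    have h1 := hd.tendsto_slope_zero
    have h2 : Tendsto (fun m : ℕ => (m : ℝ)⁻¹) atTop (𝓝[≠] 0) := by
      refine tendsto_nhdsWithin_iff.2 ⟨tendsto_inv_atTop_nhds_zero_nat, ?_⟩
      filter_upwards [eventually_gt_atTop 0] with m hm
      simpa using hm.ne'
    have h3 := (h1.comp h2).norm
    simp only [norm_zero] at h3
    refine h3.congr fun m => ?_
    simp [norm_smul]
  set K := Real.exp (‖A‖ + ‖B‖)
  have key : ∀ m : ℕ, 0 < m → ‖(exp ((m : ℝ)⁻¹ • A) * exp ((m : ℝ)⁻¹ • B)) ^ m - exp (A + B)‖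
      ≤ K * ((m : ℝ) * ‖exp ((m : ℝ)⁻¹ • A) * exp ((m : ℝ)⁻¹ • B)
      - exp ((m : ℝ)⁻¹ • (A + B))‖) := by
    intro m hm
    have hm' : (m : ℝ) ≠ 0 := by exact_mod_cast hm.ne'
    have hi : (0 : ℝ) ≤ (m : ℝ)⁻¹ := by positivity
    have hn : ∀ C : 𝔸, ‖exp ((m : ℝ)⁻¹ • C)‖ ≤ Real.exp ((m : ℝ)⁻¹ * ‖C‖) := fun C => by
      refine (norm_exp_le_exp_norm _).trans_eq ?_
      rw [norm_smul, Real.norm_of_nonneg hi]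
    have h1 : exp (A + B) = exp ((m : ℝ)⁻¹ • (A + B)) ^ m := by
      rw [← NormedSpace.exp_nsmul, ← Nat.cast_smul_eq_nsmul ℝ, smul_smul,
        mul_inv_cancel₀ hm', one_smul]
    -- This c bounds both factors, and its m-th power is K, independent of m.
    have h2 := norm_pow_sub_pow_le (c := Real.exp ((m : ℝ)⁻¹ * (‖A‖ + ‖B‖)))
      (U := exp ((m : ℝ)⁻¹ • A) * exp ((m : ℝ)⁻¹ • B)) (V := exp ((m : ℝ)⁻¹ • (A + B)))
      (Real.one_le_exp (by positivity))
      (by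
        rw [mul_add, Real.exp_add]
        exact (norm_mul_le _ _).trans (mul_le_mul (hn A) (hn B) (norm_nonneg _) (Real.exp_nonneg _)))
      ((hn _).trans (Real.exp_le_exp.2 (mul_le_mul_of_nonneg_left (norm_add_le _ _) hi))) m
    rw [← Real.exp_nat_mul, ← mul_assoc, mul_inv_cancel₀ hm', one_mul] at h2
    rw [h1]
    exact h2.trans_eq (by ring)
  rw [tendsto_iff_norm_sub_tendsto_zero]
  refine squeeze_zero' (.of_forall fun _ => norm_nonneg _)
    ((eventually_gt_atTop 0).mono fun m hm => key m hm) ?_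
  simpa using hlim.const_mul K

end Lie

/-! ### A quadratic bound for the scalar exponential -/

theorem Real.exp_le_one_add_add_sq {x : ℝ} (hx : x ≤ 3 / 2) : Real.exp x ≤ 1 + x + x ^ 2 := by
  rcases le_total x (-1) with h1 | h1
  · have := Real.exp_le_one_iff.2 (show x ≤ 0 by linarith)
    nlinarith
  rcases le_total x 1 with h2 | h2
  · have := Real.abs_exp_sub_one_sub_id_le (abs_le.2 ⟨h1, h2⟩)
    linarith [(abs_le.1 this).2]
  · have h3 := convexOn_exp.2 (Set.mem_univ 1) (Set.mem_univ (3 / 2))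
      (show 0 ≤ 3 - 2 * x by linarith) (show 0 ≤ 2 * x - 2 by linarith) (by ring)
    simp only [smul_eq_mul] at h3
    rw [show (3 - 2 * x) * 1 + (2 * x - 2) * (3 / 2) = x by ring] at h3
    have h4 := Real.exp_one_lt_d9
    have h5 : Real.exp (3 / 2) ≤ 4.49 := by
      refine abs_le_of_sq_le_sq' ?_ (by norm_num) |>.2
      have : Real.exp (3 / 2) ^ 2 = Real.exp 1 ^ 3 := by
        rw [← Real.exp_nat_mul, ← Real.exp_nat_mul]; norm_num
      rw [this]
      exact (pow_le_pow_left₀ (Real.exp_pos 1).le h4.le 3).trans (by norm_num)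
    nlinarith [mul_le_mul_of_nonneg_left h4.le (show 0 ≤ 3 - 2 * x by linarith),
      mul_le_mul_of_nonneg_left h5 (show 0 ≤ 2 * x - 2 by linarith), sq_nonneg (x - 1.26)]

/-! ### Spectral calculus and Golden–Thompson -/

section Spectral
open scoped Matrix.Norms.L2Operator MatrixOrder
open NormedSpace (exp)

variable {n : Type*} [Fintype n] [DecidableEq n]

theorem continuous_matrix_exp : Continuous (fun A : Matrix n n ℝ => exp A) := by
  let +nondep : NormedAlgebra ℚ (Matrix n n ℝ) := .restrictScalars ℚ ℝ _
  exact NormedSpace.exp_continuous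

theorem exists_eq_mul_diagonal_mul_transpose [Nonempty n] {A : Matrix n n ℝ}
    (hA : A.IsSymm) :
    ∃ (U : Matrix n n ℝ) (v : n → ℝ), Uᵀ * U = 1 ∧ U * Uᵀ = 1 ∧ A = U * diagonal v * Uᵀ ∧
      ∀ i, |v i| ≤ ‖A‖ := by
  have hH : A.IsHermitian := by rwa [Matrix.IsHermitian, conjTranspose_eq_transpose_of_trivial]
  refine ⟨hH.eigenvectorUnitary, hH.eigenvalues, ?_, ?_, ?_, fun i => ?_⟩
  · rw [← conjTranspose_eq_transpose_of_trivial]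
    exact Unitary.coe_star_mul_self hH.eigenvectorUnitary
  · rw [← conjTranspose_eq_transpose_of_trivial]
    exact Unitary.coe_mul_star_self hH.eigenvectorUnitary
  · rw [← conjTranspose_eq_transpose_of_trivial]
    have := hH.spectral_theorem
    rw [Unitary.conjStarAlgAut_apply] at this
    exact this
  · exact spectrum.norm_le_norm_of_mem (hH.eigenvalues_mem_spectrum_real i)

theorem exp_mul_diagonal_mul_transpose {U : Matrix n n ℝ} (h : Uᵀ * U = 1) (v : n → ℝ) :
    exp (U * diagonal v * Uᵀ) = U * diagonal (fun i => Real.exp (v i)) * Uᵀ := by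
  have h' : U * Uᵀ = 1 := mul_eq_one_comm.1 h
  have := Matrix.exp_units_conj (⟨U, Uᵀ, h', h⟩ : (Matrix n n ℝ)ˣ) (diagonal v)
  simp only [Units.inv_mk, exp_diagonal] at this
  rw [this]
  congr 3
  ext i
  rw [Real.exp_eq_exp_ℝ, Pi.coe_exp]

theorem posSemidef_mul_diagonal_mul_transpose (U : Matrix n n ℝ) {v : n → ℝ} (hv : ∀ i, 0 ≤ v i) :
    (U * diagonal v * Uᵀ).PosSemidef := by
  have := (PosSemidef.diagonal hv).mul_mul_conjTranspose_same U
  rwa [conjTranspose_eq_transpose_of_trivial] at this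

theorem trace_mul_nonneg_of_posSemidef {P Q : Matrix n n ℝ} (hP : P.PosSemidef)
    (hQ : Q.PosSemidef) :
    0 ≤ (P * Q).trace := by
  obtain ⟨B, rfl⟩ := CStarAlgebra.nonneg_iff_eq_star_mul_self.1 hP.nonneg
  rw [mul_assoc, trace_mul_comm]
  exact (hQ.mul_mul_conjTranspose_same B).trace_nonneg

variable [Nonempty n]

theorem posSemidef_exp {A : Matrix n n ℝ} (hA : A.IsSymm) : (exp A).PosSemidef := by
  obtain ⟨U, v, h1, -, rfl, -⟩ := exists_eq_mul_diagonal_mul_transpose hA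
  rw [exp_mul_diagonal_mul_transpose h1]
  exact posSemidef_mul_diagonal_mul_transpose U fun i => (Real.exp_pos _).le

/-- The exponential lies above its tangent line at b; diagonalising transfers this to matrices. -/
theorem posSemidef_exp_sub {A : Matrix n n ℝ} (hA : A.IsSymm) (b : ℝ) :
    (exp A - Real.exp b • (1 + (A - b • 1))).PosSemidef := by
  obtain ⟨U, v, h1, h2, rfl, -⟩ := exists_eq_mul_diagonal_mul_transpose hA
  rw [exp_mul_diagonal_mul_transpose h1]
  have : U * diagonal (fun i => Real.exp (v i)) * Uᵀ
      - Real.exp b • (1 + (U * diagonal v * Uᵀ - b • 1))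
      = U * diagonal (fun i => Real.exp (v i) - Real.exp b * (1 + (v i - b))) * Uᵀ := by
    have hd : diagonal (fun i => Real.exp (v i) - Real.exp b * (1 + (v i - b)))
        = diagonal (fun i => Real.exp (v i)) - Real.exp b • (1 + (diagonal v - b • 1)) := by
      ext i j
      by_cases h : i = j <;> simp [h, diagonal, mul_add]
    rw [hd]
    simp only [mul_sub, sub_mul, mul_add, add_mul, mul_smul_comm, smul_mul_assoc, mul_one, h2,
      mul_assoc]
  rw [this]
  refine posSemidef_mul_diagonal_mul_transpose U fun i => ?_
  have h3 := mul_le_mul_of_nonneg_left (Real.add_one_le_exp (v i - b)) (Real.exp_pos b).le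
  rw [← Real.exp_add] at h3
  simp only [add_sub_cancel] at h3
  linarith

theorem posSemidef_quadratic_sub_exp {A : Matrix n n ℝ} (hA : A.IsSymm)
    (h : ‖A‖ ≤ 3 / 2) :
    (1 + A + A ^ 2 - exp A).PosSemidef := by
  obtain ⟨U, v, h1, h2, hU, hv⟩ := exists_eq_mul_diagonal_mul_transpose hA
  have hsq : A ^ 2 = U * diagonal (fun i => v i ^ 2) * Uᵀ := by
    have : U * diagonal v * Uᵀ * (U * diagonal v * Uᵀ)
        = U * (diagonal v * (Uᵀ * U) * diagonal v) * Uᵀ := by simp only [mul_assoc]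
    rw [sq, hU, this, h1, mul_one, diagonal_mul_diagonal]
    simp only [sq]
  have : 1 + A + A ^ 2 - exp A
      = U * diagonal (fun i => 1 + v i + v i ^ 2 - Real.exp (v i)) * Uᵀ := by
    have hd : diagonal (fun i => 1 + v i + v i ^ 2 - Real.exp (v i))
        = 1 + diagonal v + diagonal (fun i => v i ^ 2) - diagonal (fun i => Real.exp (v i)) := by
      ext i j
      by_cases h : i = j <;> simp [h, diagonal]
    rw [hd, hsq, hU, exp_mul_diagonal_mul_transpose h1]
    simp only [mul_sub, sub_mul, mul_add, add_mul, mul_one, h2]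
  rw [this]
  refine posSemidef_mul_diagonal_mul_transpose U fun i => ?_
  have := Real.exp_le_one_add_add_sq ((le_abs_self _).trans ((hv i).trans h))
  linarith

/-- Convexity of the trace exponential. -/
theorem trace_exp_mul_one_add_le {B W : Matrix n n ℝ} (hB : B.IsSymm) (hW : W.IsSymm) :
    (exp B * (1 + W)).trace ≤ (exp (B + W)).trace := by
  obtain ⟨U, b, h1, h2, hU, -⟩ := exists_eq_mul_diagonal_mul_transpose hB
  have hC : (B + W).IsSymm := hB.add hW
  have h3 : (exp B * (1 + W)).trace = ∑ i, Real.exp (b i) * (1 + (Uᵀ * W * U) i i) := by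
    rw [hU, exp_mul_diagonal_mul_transpose h1, mul_assoc, mul_assoc, trace_mul_comm]
    have : diagonal (fun i => Real.exp (b i)) * (Uᵀ * (1 + W)) * U
        = diagonal (fun i => Real.exp (b i)) * (1 + Uᵀ * W * U) := by
      simp only [mul_assoc, mul_add, add_mul, mul_one, h1]
    rw [this]
    simp [Matrix.trace, diagonal_mul]
  have h4 : (exp (B + W)).trace = ∑ i, (Uᵀ * exp (B + W) * U) i i := by
    calc (exp (B + W)).trace = (exp (B + W) * (U * Uᵀ)).trace := by rw [h2, mul_one]
      _ = (Uᵀ * exp (B + W) * U).trace := by rw [← mul_assoc, trace_mul_comm, ← mul_assoc]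
  rw [h3, h4]
  refine Finset.sum_le_sum fun i _ => ?_
  -- In the eigenbasis of B, the i-th diagonal entry is compared using the tangent at the i-th
  -- eigenvalue of B.
  have h5 := ((posSemidef_exp_sub hC (b i)).conjTranspose_mul_mul_same U).diag_nonneg (i := i)
  have h6 : Uᴴ * (exp (B + W) - Real.exp (b i) • (1 + (B + W - b i • 1))) * U
      = Uᵀ * exp (B + W) * U - Real.exp (b i) • (1 + (diagonal b + Uᵀ * W * U - b i • 1)) := by
    have h7 : Uᵀ * B * U = diagonal b := by
      calc Uᵀ * B * U = (Uᵀ * U) * diagonal b * (Uᵀ * U) := by rw [hU]; simp only [mul_assoc]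
        _ = diagonal b := by rw [h1]; simp
    rw [conjTranspose_eq_transpose_of_trivial, ← h7]
    simp only [mul_sub, sub_mul, mul_add, add_mul, mul_smul_comm, smul_mul_assoc, mul_one, h1]
  rw [h6] at h5
  simp at h5
  linarith

/-- The Golden-Thompson inequality for real symmetric matrices. -/
theorem trace_exp_add_le {A B : Matrix n n ℝ} (hA : A.IsSymm) (hB : B.IsSymm) :
    (exp (A + B)).trace ≤ (exp A * exp B).trace := by
  -- The trace inequality is known for exponents 2^j only, so the limit is taken along that
  -- subsequence.
  have h := (tendsto_exp_mul_exp_pow A B).comp (tendsto_pow_atTop_atTop_of_one_lt one_lt_two)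
  have h1 := ((continuous_id.matrix_trace).tendsto (exp (A + B))).comp h
  refine le_of_tendsto h1 (.of_forall fun j => ?_)
  have hc : (((2 ^ j : ℕ) : ℝ)) ≠ 0 := by positivity
  have hs : ∀ C : Matrix n n ℝ, exp (((2 ^ j : ℕ) : ℝ)⁻¹ • C) ^ 2 ^ j = exp C := fun C => by
    rw [← Matrix.exp_nsmul, ← Nat.cast_smul_eq_nsmul ℝ, smul_smul, mul_inv_cancel₀ hc, one_smul]
  have := (trace_pow_two_pow_le j).2 _ _ (hA.smul (((2 ^ j : ℕ) : ℝ)⁻¹)).exp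
    (hB.smul (((2 ^ j : ℕ) : ℝ)⁻¹)).exp
  rw [hs, hs] at this
  exact this

theorem trace_exp_add_le_of_norm_le {A X : Matrix n n ℝ} (hA : A.IsSymm) (hX : X.IsSymm)
    (h : ‖X‖ ≤ 3 / 2) : (exp (A + X)).trace ≤ (exp A * (1 + X + X ^ 2)).trace := by
  have h1 := trace_mul_nonneg_of_posSemidef (posSemidef_exp hA) (posSemidef_quadratic_sub_exp hX h)
  rw [mul_sub, trace_sub] at h1
  linarith [trace_exp_add_le hA hX]

end Spectral

/-! ### Degrees in sums of squares -/

section SumSq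
open MvPolynomial MonomialOrder

variable {d : ℕ}

/-- Nonnegative leading terms in a graded order cannot cancel. This is needed because the
certificate in `SosLE` carries no degree bound on its squares, while pseudoexpectations are positive
only in degree at most 2r. -/
theorem totalDegree_le_of_leadingCoeff_nonneg {a s : MvPolynomial (Fin d) ℝ}
    (ha : 0 ≤ degLex.leadingCoeff a) (hs : 0 ≤ degLex.leadingCoeff s) :
    0 ≤ degLex.leadingCoeff (a + s) ∧ a.totalDegree ≤ (a + s).totalDegree ∧
      s.totalDegree ≤ (a + s).totalDegree := by
  rcases lt_trichotomy (degLex.toSyn (degLex.degree s)) (degLex.toSyn (degLex.degree a)) with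
    h | h | h
  · have h1 := degree_add_of_lt h
    refine ⟨by rwa [leadingCoeff_add_of_lt h], ?_, ?_⟩
    · exact degLex_totalDegree_monotone (by rw [h1])
    · exact degLex_totalDegree_monotone (by rw [h1]; exact h.le)
  · by_cases ha0 : a = 0
    · simp [ha0, hs]
    by_cases hs0 : s = 0
    · simp [hs0, ha]
    have hd : degLex.degree s = degLex.degree a := degLex.toSyn.injective h
    have ha' : 0 < degLex.leadingCoeff a :=
      lt_of_le_of_ne ha (Ne.symm (leadingCoeff_ne_zero_iff.2 ha0))
    have hc : 0 < coeff (degLex.degree a) (a + s) := by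
      rw [coeff_add]
      have : coeff (degLex.degree a) s = degLex.leadingCoeff s := by rw [← hd]; rfl
      rw [this]
      exact add_pos_of_pos_of_nonneg ha' hs
    have h1 : degLex.toSyn (degLex.degree a) ≤ degLex.toSyn (degLex.degree (a + s)) :=
      degLex.le_degree (mem_support_iff.2 hc.ne')
    have h2 : degLex.toSyn (degLex.degree (a + s)) ≤ degLex.toSyn (degLex.degree a) :=
      degree_add_le.trans (by rw [h, max_self])
    have h3 : degLex.degree (a + s) = degLex.degree a := degLex.toSyn.injective (le_antisymm h2 h1)
    refine ⟨?_, degLex_totalDegree_monotone h1, degLex_totalDegree_monotone (by rwa [hd])⟩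
    rw [leadingCoeff, h3]
    exact hc.le
  · have h1 := degree_add_eq_right_of_lt h
    refine ⟨by rwa [add_comm, leadingCoeff_add_of_lt h], ?_, ?_⟩
    · exact degLex_totalDegree_monotone (by rw [h1]; exact h.le)
    · exact degLex_totalDegree_monotone (by rw [h1])

theorem IsSumSq.leadingCoeff_nonneg {s : MvPolynomial (Fin d) ℝ} (hs : IsSumSq s) :
    0 ≤ degLex.leadingCoeff s := by
  induction hs with
  | zero => simp
  | sq_add a _ ih =>
    refine (totalDegree_le_of_leadingCoeff_nonneg ?_ ih).1
    rw [leadingCoeff_mul]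
    exact mul_self_nonneg _

theorem IsSumSq.totalDegree_le_of_mul_self_add {s : MvPolynomial (Fin d) ℝ} (hs : IsSumSq s)
    (a : MvPolynomial (Fin d) ℝ) : (a * a).totalDegree ≤ (a * a + s).totalDegree ∧
      s.totalDegree ≤ (a * a + s).totalDegree := by
  refine (totalDegree_le_of_leadingCoeff_nonneg ?_ hs.leadingCoeff_nonneg).2
  rw [leadingCoeff_mul]
  exact mul_self_nonneg _

end SumSq

/-! ### Pseudoexpectations of tensor forms -/

section Pseudoexpectation
open MvPolynomial

variable {d : ℕ}

/-- A linear functional on all real polynomials whose restriction to the polynomials of degree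
at most `2 * r` is a pseudoexpectation satisfying `‖u‖² = 1`. -/
structure IsSphereFunctional (r : ℕ) (F : MvPolynomial (Fin d) ℝ →ₗ[ℝ] ℝ) : Prop where
  map_one : F 1 = 1
  map_sq_nonneg : ∀ p : MvPolynomial (Fin d) ℝ, (p ^ 2).totalDegree ≤ 2 * r → 0 ≤ F (p ^ 2)
  map_sphere : ∀ q : MvPolynomial (Fin d) ℝ, ((∑ j, X j ^ 2 - 1) * q).totalDegree ≤ 2 * r →
    F ((∑ j, X j ^ 2 - 1) * q) = 0

/-- An arbitrary linear extension suffices: only degrees up to 2r are ever constrained, and degree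
conditions become side goals rather than part of the type. -/
theorem IsSpherePseudoexpectation.exists_extension {r : ℕ}
    {E : restrictTotalDegree (Fin d) ℝ (2 * r) →ₗ[ℝ] ℝ} (hE : IsSpherePseudoexpectation E) :
    ∃ F : MvPolynomial (Fin d) ℝ →ₗ[ℝ] ℝ, (∀ p, E p = F p) ∧ IsSphereFunctional r F := by
  obtain ⟨F, hF⟩ := E.exists_extend
  have hF' : ∀ p, E p = F p := fun p => by rw [← hF]; rfl
  refine ⟨F, hF', ?_, fun p hp => ?_, fun q hq => ?_⟩
  · have h : (1 : MvPolynomial (Fin d) ℝ) ∈ restrictTotalDegree (Fin d) ℝ (2 * r) := by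
      simp [mem_restrictTotalDegree]
    exact (hF' ⟨1, h⟩).symm.trans (hE.map_one h)
  · have h := (mem_restrictTotalDegree (Fin d) (2 * r) _).2 hp
    exact (hE.map_sq_nonneg p h).trans_eq (hF' ⟨_, h⟩)
  · have h := (mem_restrictTotalDegree (Fin d) (2 * r) _).2 hq
    exact (hF' ⟨_, h⟩).symm.trans (hE.map_sphere q h)

theorem totalDegree_tensorPow_mul_le {r : ℕ} (α β : Fin r → Fin d) :
    (tensorPow r (X : Fin d → MvPolynomial (Fin d) ℝ) α * tensorPow r X β).totalDegree
      ≤ 2 * r := by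
  refine (totalDegree_mul _ _).trans ?_
  have := tensorPow_X_totalDegree_le α
  have := tensorPow_X_totalDegree_le β
  omega

theorem totalDegree_sum_X_sq_le : (∑ j, X j ^ 2 : MvPolynomial (Fin d) ℝ).totalDegree ≤ 2 := by
  refine (totalDegree_finsetSum _ _).trans (Finset.sup_le fun j _ => ?_)
  exact (totalDegree_pow _ _).trans (by simp)

theorem totalDegree_sum_X_sq_pow_le (j : ℕ) :
    ((∑ j, X j ^ 2 : MvPolynomial (Fin d) ℝ) ^ j).totalDegree ≤ 2 * j := by
  refine (totalDegree_pow _ _).trans ?_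
  rw [mul_comm]
  exact Nat.mul_le_mul_right _ totalDegree_sum_X_sq_le

theorem sum_tensorPow_sq {A : Type*} [CommSemiring A] (r : ℕ) (u : Fin d → A) :
    ∑ α, tensorPow r u α ^ 2 = (∑ j, u j ^ 2) ^ r := by
  rw [Fintype.sum_pow]
  simp [tensorPow, Finset.prod_pow]

theorem tensorFormPoly_eq_sum {r : ℕ} (A : Matrix (Fin r → Fin d) (Fin r → Fin d) ℝ) :
    tensorFormPoly A = ∑ α, ∑ β, A α β • (tensorPow r X α * tensorPow r X β) := by
  simp only [tensorFormPoly, dotProduct, mulVec, Finset.mul_sum, Matrix.map_apply]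
  refine Finset.sum_congr rfl fun α _ => Finset.sum_congr rfl fun β _ => ?_
  rw [smul_eq_C_mul]; ring

theorem eval_tensorPow_X {r : ℕ} (u : Fin d → ℝ) (α : Fin r → Fin d) :
    eval u (tensorPow r X α) = tensorPow r u α := by
  simp [tensorPow]

theorem eval_tensorFormPoly {r : ℕ} (A : Matrix (Fin r → Fin d) (Fin r → Fin d) ℝ)
    (u : Fin d → ℝ) :
    eval u (tensorFormPoly A) = tensorPow r u ⬝ᵥ (A *ᵥ tensorPow r u) := by
  rw [tensorFormPoly_eq_sum]
  simp only [map_sum, smul_eval, map_mul, eval_tensorPow_X, dotProduct, mulVec, Finset.mul_sum]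
  refine Finset.sum_congr rfl fun α _ => Finset.sum_congr rfl fun β _ => ?_
  ring

theorem LinearMap.map_tensorFormPoly {r : ℕ} (F : MvPolynomial (Fin d) ℝ →ₗ[ℝ] ℝ)
    (A : Matrix (Fin r → Fin d) (Fin r → Fin d) ℝ) :
    F (tensorFormPoly A) = ∑ α, ∑ β, A α β * F (tensorPow r X α * tensorPow r X β) := by
  simp [tensorFormPoly_eq_sum]

namespace IsSphereFunctional

variable {r : ℕ} {F : MvPolynomial (Fin d) ℝ →ₗ[ℝ] ℝ} (hF : IsSphereFunctional r F)
include hF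

theorem nonneg_of_isSumSq {s : MvPolynomial (Fin d) ℝ} (hs : IsSumSq s)
    (hd : s.totalDegree ≤ 2 * r) : 0 ≤ F s := by
  induction hs with
  | zero => simp
  | sq_add a hs ih =>
    obtain ⟨h1, h2⟩ := hs.totalDegree_le_of_mul_self_add a
    rw [map_add, ← sq]
    rw [← sq] at h1
    exact add_nonneg (hF.map_sq_nonneg a (h1.trans (by rwa [sq]))) (ih (h2.trans hd))

theorem map_sum_X_sq_pow {j : ℕ} (hj : j ≤ r) : F ((∑ i, X i ^ 2) ^ j) = 1 := by
  induction j with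
  | zero => simpa using hF.map_one
  | succ j ih =>
    have h1 : ((∑ i, X i ^ 2 - 1 : MvPolynomial (Fin d) ℝ) * (∑ i, X i ^ 2) ^ j)
        = (∑ i, X i ^ 2) ^ (j + 1) - (∑ i, X i ^ 2) ^ j := by ring
    have h2 := hF.map_sphere ((∑ i, X i ^ 2) ^ j) (by
      rw [h1]
      refine (totalDegree_sub _ _).trans (max_le ?_ ?_)
      · exact (totalDegree_sum_X_sq_pow_le _).trans (by omega)
      · exact (totalDegree_sum_X_sq_pow_le _).trans (by omega))
    rw [h1, map_sub, ih (by omega)] at h2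
    linarith

/-- The squared monomials of degree j sum to ‖u‖^(2j), which has value 1, and each has nonnegative
value. -/
theorem map_tensorPow_sq_le {j : ℕ} (hj : j ≤ r) (α : Fin j → Fin d) :
    F (tensorPow j X α ^ 2) ≤ 1 := by
  rw [← hF.map_sum_X_sq_pow hj, ← sum_tensorPow_sq, map_sum]
  refine Finset.single_le_sum (f := fun α => F (tensorPow j X α ^ 2)) (fun β _ => ?_)
    (Finset.mem_univ α)
  refine hF.map_sq_nonneg _ ?_
  rw [sq]
  exact (totalDegree_tensorPow_mul_le _ _).trans (by omega)

theorem abs_map_mul_le {p q : MvPolynomial (Fin d) ℝ} (hp : p.totalDegree ≤ r)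
    (hq : q.totalDegree ≤ r) (hp1 : F (p ^ 2) ≤ 1) (hq1 : F (q ^ 2) ≤ 1) : |F (p * q)| ≤ 1 := by
  have h1 := hF.map_sq_nonneg (p + q) ((totalDegree_pow _ _).trans
    (Nat.mul_le_mul_left _ ((totalDegree_add _ _).trans (max_le hp hq))))
  have h2 := hF.map_sq_nonneg (p - q) ((totalDegree_pow _ _).trans
    (Nat.mul_le_mul_left _ ((totalDegree_sub _ _).trans (max_le hp hq))))
  have e1 : (p + q) ^ 2 = p ^ 2 + q ^ 2 + (2 : ℝ) • (p * q) := by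
    rw [smul_eq_C_mul]; simp only [map_ofNat]; ring
  have e2 : (p - q) ^ 2 = p ^ 2 + q ^ 2 - (2 : ℝ) • (p * q) := by
    rw [smul_eq_C_mul]; simp only [map_ofNat]; ring
  rw [e1, map_add, map_add, map_smul, smul_eq_mul] at h1
  rw [e2, map_sub, map_add, map_smul, smul_eq_mul] at h2
  exact abs_le.2 ⟨by linarith, by linarith⟩

theorem abs_map_tensorPow_mul_le (α β : Fin r → Fin d) :
    |F (tensorPow r X α * tensorPow r X β)| ≤ 1 :=
  hF.abs_map_mul_le (tensorPow_X_totalDegree_le α) (tensorPow_X_totalDegree_le β)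
    (hF.map_tensorPow_sq_le le_rfl α) (hF.map_tensorPow_sq_le le_rfl β)

/-- A monomial of degree at most 2r splits into two of degree at most r, to which the Cauchy–Schwarz
type bound applies. -/
theorem abs_map_list_prod_le {l : List (Fin d)} (hl : l.length ≤ 2 * r) :
    |F (l.map X).prod| ≤ 1 := by
  have h : ∀ l : List (Fin d), (l.map (X : Fin d → MvPolynomial (Fin d) ℝ)).prod
      = tensorPow l.length X l.get := fun l => by
    simp [tensorPow]
  rw [← List.take_append_drop r l, List.map_append, List.prod_append, h, h]
  have h1 : (l.take r).length ≤ r := by simp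
  have h2 : (l.drop r).length ≤ r := by rw [List.length_drop]; omega
  exact hF.abs_map_mul_le ((tensorPow_X_totalDegree_le _).trans h1)
    ((tensorPow_X_totalDegree_le _).trans h2) (hF.map_tensorPow_sq_le h1 _)
    (hF.map_tensorPow_sq_le h2 _)

theorem abs_map_le {p : MvPolynomial (Fin d) ℝ} (hp : p.totalDegree ≤ 2 * r) :
    |F p| ≤ ∑ e ∈ p.support, |coeff e p| := by
  conv_lhs => rw [p.as_sum, map_sum]
  refine (Finset.abs_sum_le_sum_abs _ _).trans (Finset.sum_le_sum fun e he => ?_)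
  have h1 : monomial e (coeff e p) = coeff e p • ((Finsupp.toMultiset e).toList.map X).prod := by
    rw [← Multiset.prod_coe, ← Multiset.map_coe, Multiset.coe_toList, smul_eq_C_mul, monomial_eq]
    rw [Finsupp.toMultiset_map, Finsupp.prod_toMultiset, Finsupp.prod_mapDomain_index
      (fun _ => pow_zero _) (fun _ _ _ => pow_add _ _ _)]
  rw [h1, map_smul, smul_eq_mul, abs_mul]
  refine mul_le_of_le_one_right (abs_nonneg _) (hF.abs_map_list_prod_le ?_)
  rw [Multiset.length_toList, Finsupp.card_toMultiset]
  exact (le_totalDegree he).trans hp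

theorem map_tensorFormPoly_one :
    F (tensorFormPoly (1 : Matrix (Fin r → Fin d) (Fin r → Fin d) ℝ)) = 1 := by
  rw [← hF.map_sum_X_sq_pow le_rfl, ← sum_tensorPow_sq, F.map_tensorFormPoly, map_sum]
  simp [Matrix.one_apply, sq]

theorem map_tensorFormPoly_nonneg {A : Matrix (Fin r → Fin d) (Fin r → Fin d) ℝ}
    (hA : A.PosSemidef) : 0 ≤ F (tensorFormPoly A) := by
  open scoped MatrixOrder Matrix.Norms.L2Operator in
  obtain ⟨B, rfl⟩ := CStarAlgebra.nonneg_iff_eq_star_mul_self.1 hA.nonneg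
  have h : tensorFormPoly (star B * B)
      = ∑ γ, (∑ α, B γ α • tensorPow r (X : Fin d → MvPolynomial (Fin d) ℝ) α) ^ 2 := by
    simp only [tensorFormPoly_eq_sum, sq, Finset.sum_mul_sum, Matrix.mul_apply, Finset.sum_smul,
      Matrix.star_apply, star_trivial, smul_mul_smul_comm]
    rw [Finset.sum_comm_cycle]
  rw [h, map_sum]
  refine Finset.sum_nonneg fun γ _ => hF.map_sq_nonneg _ ?_
  refine (totalDegree_pow _ _).trans (Nat.mul_le_mul_left _ ?_)
  exact (totalDegree_finsetSum _ _).trans (Finset.sup_le fun α _ =>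
    (totalDegree_smul_le _ _).trans (tensorPow_X_totalDegree_le α))

/-- L = log tr exp A dominates every eigenvalue, so L · 1 − A is positive semidefinite and its form
is a sum of squares; the form of 1 is ‖u‖^(2r), of value 1. -/
theorem map_tensorFormPoly_le_log_trace_exp {A : Matrix (Fin r → Fin d) (Fin r → Fin d) ℝ}
    [Nonempty (Fin r → Fin d)] (hA : A.IsSymm) :
    F (tensorFormPoly A) ≤ Real.log (NormedSpace.exp A).trace := by
  obtain ⟨U, v, h1, h2, hU, -⟩ := exists_eq_mul_diagonal_mul_transpose hA
  set L := Real.log (NormedSpace.exp A).trace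
  have h3 : (NormedSpace.exp A).trace = ∑ i, Real.exp (v i) := by
    rw [hU, exp_mul_diagonal_mul_transpose h1, trace_mul_comm, ← mul_assoc, h1, one_mul,
      trace_diagonal]
  have h4 : ∀ i, 0 ≤ L - v i := fun i => by
    have : Real.exp (v i) ≤ (NormedSpace.exp A).trace := by
      rw [h3]
      exact Finset.single_le_sum (f := fun i => Real.exp (v i)) (fun j _ => (Real.exp_pos _).le)
        (Finset.mem_univ i)
    exact sub_nonneg.2 ((Real.le_log_iff_exp_le ((Real.exp_pos _).trans_le this)).2 this)
  have h5 : L • 1 - A = U * diagonal (fun i => L - v i) * Uᵀ := by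
    have : diagonal (fun i => L - v i) = L • 1 - diagonal v := by
      ext i j
      by_cases h : i = j <;> simp [h, diagonal]
    rw [this, mul_sub, sub_mul, ← hU]
    simp [h2]
  have h6 := hF.map_tensorFormPoly_nonneg (h5 ▸ posSemidef_mul_diagonal_mul_transpose U h4)
  have h7 : F (tensorFormPoly (L • 1 - A)) = L * F (tensorFormPoly
      (1 : Matrix (Fin r → Fin d) (Fin r → Fin d) ℝ)) - F (tensorFormPoly A) := by
    simp only [F.map_tensorFormPoly, Finset.mul_sum, ← Finset.sum_sub_distrib]
    refine Finset.sum_congr rfl fun α _ => Finset.sum_congr rfl fun β _ => ?_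
    simp [sub_mul, mul_assoc]
  rw [h7, hF.map_tensorFormPoly_one] at h6
  linarith

theorem map_tensorFormPoly_le_of_sosLE {A : Matrix (Fin r → Fin d) (Fin r → Fin d) ℝ} {c : ℝ}
    (h : SosLE (fun u : Fin d → ℝ => tensorPow r u ⬝ᵥ (A *ᵥ tensorPow r u))
      (fun u : Fin d → ℝ => c * ‖WithLp.toLp 2 u‖ ^ (2 * r))) : F (tensorFormPoly A) ≤ c := by
  obtain ⟨s, hs, hu⟩ := h
  -- Equality of functions gives equality of polynomials, which bounds the degree of s by 2r.
  have h1 : s = c • (∑ j, X j ^ 2) ^ r - tensorFormPoly A := by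
    refine MvPolynomial.funext fun u => ?_
    rw [← hu, map_sub, smul_eval, eval_tensorFormPoly]
    simp only [pow_mul, EuclideanSpace.real_norm_sq_eq]
    simp
  have h2 : 0 ≤ F s := by
    refine hF.nonneg_of_isSumSq hs ?_
    rw [h1]
    refine (totalDegree_sub _ _).trans (max_le ?_ ?_)
    · exact (totalDegree_smul_le _ _).trans (totalDegree_sum_X_sq_pow_le r)
    · exact (mem_restrictTotalDegree _ _ _).1 (tensorFormPoly_mem A)
  rw [h1, map_sub, map_smul, hF.map_sum_X_sq_pow le_rfl] at h2
  simpa using h2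

end IsSphereFunctional
end Pseudoexpectation

/-! ### Attainment and continuity of the maximum -/

section SosMax
open MvPolynomial

variable {d r : ℕ}

theorem IsSphereFunctional.isSpherePseudoexpectation {F : MvPolynomial (Fin d) ℝ →ₗ[ℝ] ℝ}
    (hF : IsSphereFunctional r F) : IsSpherePseudoexpectation
      (F.comp (restrictTotalDegree (Fin d) ℝ (2 * r)).subtype) where
  map_one _ := hF.map_one
  map_sq_nonneg p h := hF.map_sq_nonneg p ((mem_restrictTotalDegree _ _ _).1 h)
  map_sphere q h := hF.map_sphere q ((mem_restrictTotalDegree _ _ _).1 h)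

theorem exists_isSphereFunctional (hd : 1 ≤ d) (r : ℕ) :
    ∃ F : MvPolynomial (Fin d) ℝ →ₗ[ℝ] ℝ, IsSphereFunctional r F := by
  -- Evaluation at the first basis vector, a point of the sphere.
  refine ⟨(aeval (Pi.single (⟨0, hd⟩ : Fin d) (1 : ℝ))).toLinearMap, ?_, fun p _ => ?_,
    fun q _ => ?_⟩
  · simp
  · simp only [AlgHom.toLinearMap_apply, map_pow]
    exact sq_nonneg _
  · simp [Pi.single_apply]

/-- Tychonoff: each value is confined to an interval by the monomial bounds, and linearity and the
axioms are closed conditions on finitely many coordinates at a time. -/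
theorem isCompact_isSpherePseudoexpectation (d r : ℕ) :
    IsCompact {f : restrictTotalDegree (Fin d) ℝ (2 * r) → ℝ |
      ∃ E : restrictTotalDegree (Fin d) ℝ (2 * r) →ₗ[ℝ] ℝ,
        IsSpherePseudoexpectation E ∧ ⇑E = f} := by
  set B : restrictTotalDegree (Fin d) ℝ (2 * r) → ℝ :=
    fun p => ∑ e ∈ p.1.support, |coeff e p.1|
  refine IsCompact.of_isClosed_subset
    (isCompact_univ_pi fun p => isCompact_Icc (a := -B p) (b := B p)) ?_ ?_
  · have : {f : restrictTotalDegree (Fin d) ℝ (2 * r) → ℝ |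
        ∃ E : restrictTotalDegree (Fin d) ℝ (2 * r) →ₗ[ℝ] ℝ,
          IsSpherePseudoexpectation E ∧ ⇑E = f} =
        (⋂ p, ⋂ q, {f | f (p + q) = f p + f q}) ∩ (⋂ c : ℝ, ⋂ p, {f | f (c • p) = c * f p}) ∩
        ((⋂ h, {f | f ⟨1, h⟩ = 1}) ∩
        (⋂ p : MvPolynomial (Fin d) ℝ, ⋂ h, {f | 0 ≤ f ⟨p ^ 2, h⟩}) ∩
        (⋂ q : MvPolynomial (Fin d) ℝ, ⋂ h, {f | f ⟨(∑ j, X j ^ 2 - 1) * q, h⟩ = 0})) := by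
      ext f
      simp only [Set.mem_ofPred_eq, Set.mem_inter_iff, Set.mem_iInter]
      constructor
      · rintro ⟨E, hE, rfl⟩
        exact ⟨⟨map_add E, map_smul E⟩, ⟨hE.map_one, hE.map_sq_nonneg⟩, hE.map_sphere⟩
      · rintro ⟨⟨h1, h2⟩, ⟨h3, h4⟩, h5⟩
        exact ⟨{ toFun := f, map_add' := h1, map_smul' := h2 }, ⟨h3, h4, h5⟩, rfl⟩
    rw [this]
    refine ((isClosed_iInter fun p => isClosed_iInter fun q => ?_).inter
      (isClosed_iInter fun c => isClosed_iInter fun p => ?_)).inter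
      (((isClosed_iInter fun h => ?_).inter
        (isClosed_iInter fun p => isClosed_iInter fun h => ?_)).inter
      (isClosed_iInter fun q => isClosed_iInter fun h => ?_))
    · exact isClosed_eq (continuous_apply _) ((continuous_apply p).add (continuous_apply q))
    · exact isClosed_eq (continuous_apply _) (continuous_const.mul (continuous_apply _))
    · exact isClosed_eq (continuous_apply _) continuous_const
    · exact isClosed_le continuous_const (continuous_apply _)
    · exact isClosed_eq (continuous_apply _) continuous_const
  · rintro _ ⟨E, hE, rfl⟩ p -
    obtain ⟨F, hEF, hF⟩ := hE.exists_extension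
    rw [hEF]
    exact abs_le.1 (hF.abs_map_le ((mem_restrictTotalDegree _ _ _).1 p.2))

theorem isGreatest_sosMax (hd : 1 ≤ d) (p : restrictTotalDegree (Fin d) ℝ (2 * r)) :
    IsGreatest (sosValues p) (sosMax p) := by
  have h1 : sosValues p = (fun f : restrictTotalDegree (Fin d) ℝ (2 * r) → ℝ => f p) ''
      {f | ∃ E : restrictTotalDegree (Fin d) ℝ (2 * r) →ₗ[ℝ] ℝ,
        IsSpherePseudoexpectation E ∧ ⇑E = f} := by
    ext x
    constructor
    · rintro ⟨E, hE, rfl⟩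
      exact ⟨E, ⟨E, hE, rfl⟩, rfl⟩
    · rintro ⟨_, ⟨E, hE, rfl⟩, rfl⟩
      exact ⟨E, hE, rfl⟩
  have h2 : IsCompact (sosValues p) := by
    rw [h1]
    exact (isCompact_isSpherePseudoexpectation d r).image (continuous_apply p)
  obtain ⟨F, hF⟩ := exists_isSphereFunctional hd r
  exact h2.isGreatest_sSup ⟨_, _, hF.isSpherePseudoexpectation, rfl⟩

theorem exists_isSphereFunctional_eq_sosMax (hd : 1 ≤ d)
    (A : Matrix (Fin r → Fin d) (Fin r → Fin d) ℝ) :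
    ∃ F, IsSphereFunctional r F ∧ F (tensorFormPoly A) = sosMax (tensorForm A) := by
  obtain ⟨E, hE, h⟩ := (isGreatest_sosMax hd (tensorForm A)).1
  obtain ⟨F, hEF, hF⟩ := hE.exists_extension
  exact ⟨F, hF, by rw [← h, hEF]; rfl⟩

theorem IsSphereFunctional.le_sosMax (hd : 1 ≤ d) {F : MvPolynomial (Fin d) ℝ →ₗ[ℝ] ℝ}
    (hF : IsSphereFunctional r F) (A : Matrix (Fin r → Fin d) (Fin r → Fin d) ℝ) :
    F (tensorFormPoly A) ≤ sosMax (tensorForm A) :=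
  (isGreatest_sosMax hd (tensorForm A)).2 ⟨_, hF.isSpherePseudoexpectation, rfl⟩

/-- An optimal functional for A is a competitor for B, and its moments of degree 2r are at most 1 in
absolute value. -/
theorem sosMax_tensorForm_le_add (hd : 1 ≤ d) (A B : Matrix (Fin r → Fin d) (Fin r → Fin d) ℝ) :
    sosMax (tensorForm A) ≤ sosMax (tensorForm B) + ∑ α, ∑ β, |A α β - B α β| := by
  obtain ⟨F, hF, h⟩ := exists_isSphereFunctional_eq_sosMax hd A
  rw [← h]
  refine le_trans ?_ (add_le_add_left (hF.le_sosMax hd B) _)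
  simp only [F.map_tensorFormPoly, ← Finset.sum_add_distrib]
  refine Finset.sum_le_sum fun α _ => Finset.sum_le_sum fun β _ => ?_
  have h1 := mul_le_of_le_one_right (abs_nonneg (A α β - B α β)) (hF.abs_map_tensorPow_mul_le α β)
  rw [← abs_mul] at h1
  linarith [(le_abs_self _).trans h1]

theorem continuous_sosMax_tensorForm (hd : 1 ≤ d) :
    Continuous fun A : Matrix (Fin r → Fin d) (Fin r → Fin d) ℝ => sosMax (tensorForm A) := by
  refine continuous_iff_continuousAt.2 fun A => ?_
  have h1 : Continuous fun B : Matrix (Fin r → Fin d) (Fin r → Fin d) ℝ =>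
      ∑ α, ∑ β, |B α β - A α β| := by fun_prop
  have h2 := h1.tendsto A
  simp only [sub_self, abs_zero, Finset.sum_const_zero] at h2
  refine tendsto_iff_dist_tendsto_zero.2 (squeeze_zero (fun _ => dist_nonneg) (fun B => ?_) h2)
  have h3 := sosMax_tensorForm_le_add hd A B
  have h4 := sosMax_tensorForm_le_add hd B A
  simp only [abs_sub_comm (A _ _)] at h3
  rw [Real.dist_eq, abs_le]
  constructor <;> linarith

theorem sum_tensorForm {k : ℕ} (A : Fin k → Matrix (Fin r → Fin d) (Fin r → Fin d) ℝ) :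
    ∑ i, tensorForm (A i) = tensorForm (∑ i, A i) := by
  refine Subtype.ext ?_
  simp only [AddSubmonoidClass.coe_finsetSum, tensorForm, tensorFormPoly_eq_sum,
    Matrix.sum_apply, Finset.sum_smul]
  rw [Finset.sum_comm]
  exact Finset.sum_congr rfl fun _ _ => Finset.sum_comm

end SosMax

/-! ### The compensated trace exponential -/

section Probability
open MeasureTheory ProbabilityTheory
open scoped Matrix.Norms.L2Operator
open NormedSpace (exp)

variable {n : Type*} [Fintype n]

instance matrixBorelSpace : BorelSpace (Matrix n n ℝ) :=
  inferInstanceAs (BorelSpace (n → n → ℝ))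

instance matrixMeasurableAdd₂ : MeasurableAdd₂ (Matrix n n ℝ) :=
  ⟨measurable_pi_lambda _ fun i => measurable_pi_lambda _ fun j =>
    Measurable.add (f := fun c : Matrix n n ℝ × Matrix n n ℝ => c.1 i j) (g := fun c => c.2 i j)
      ((measurable_pi_apply j).comp ((measurable_pi_apply i).comp measurable_fst))
      ((measurable_pi_apply j).comp ((measurable_pi_apply i).comp measurable_snd))⟩

variable [DecidableEq n] {Ω : Type*} [MeasurableSpace Ω] {P : Measure Ω}

variable {k : ℕ} {M : Fin k → Ω → Matrix n n ℝ} {R : ℝ}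

theorem ae_norm_sum_le (hbound : ∀ i, ∀ᵐ ω ∂P, ‖M i ω‖ ≤ R) (s : Finset (Fin k)) :
    ∀ᵐ ω ∂P, ‖∑ i ∈ s, M i ω‖ ≤ s.card * R := by
  filter_upwards [ae_all_iff.2 hbound] with ω hω
  refine (norm_sum_le_of_le s fun i _ => hω i).trans_eq ?_
  simp

/-- The entrywise second moment of a random matrix. -/
noncomputable def secondMoment (P : Measure Ω) (Y : Ω → Matrix n n ℝ) : Matrix n n ℝ :=
  Matrix.of fun α β => ∫ ω, (Y ω ^ 2) α β ∂P

theorem isSymm_secondMoment {Y : Ω → Matrix n n ℝ} (h : ∀ᵐ ω ∂P, (Y ω).IsSymm) :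
    (secondMoment P Y).IsSymm := by
  ext α β
  refine integral_congr_ae ?_
  filter_upwards [h] with ω hω
  exact (hω.pow 2).apply α β

variable [IsProbabilityMeasure P]

theorem integrable_comp_of_norm_le {f : Matrix n n ℝ → ℝ} (hf : Continuous f)
    {Y : Ω → Matrix n n ℝ} (hY : Measurable Y) {c : ℝ} (hc : ∀ᵐ ω ∂P, ‖Y ω‖ ≤ c) :
    Integrable (fun ω => f (Y ω)) P := by
  have : ProperSpace (Matrix n n ℝ) := FiniteDimensional.proper ℝ _
  obtain ⟨C, hC⟩ := (isCompact_closedBall (0 : Matrix n n ℝ) c).exists_bound_of_continuousOn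
    hf.continuousOn
  refine Integrable.of_bound (hf.measurable.comp hY).aestronglyMeasurable C ?_
  filter_upwards [hc] with ω hω
  exact hC _ (by simpa using hω)

variable [Nonempty n]

theorem trace_exp_pos {A : Matrix n n ℝ} (hA : A.IsSymm) : 0 < (exp A).trace := by
  obtain ⟨U, v, h1, -, hU, -⟩ := exists_eq_mul_diagonal_mul_transpose hA
  rw [hU, exp_mul_diagonal_mul_transpose h1, trace_mul_comm, ← mul_assoc, h1, one_mul,
    trace_diagonal]
  exact Finset.sum_pos (fun _ _ => Real.exp_pos _) Finset.univ_nonempty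

/-- Compensating each summand by its second moment turns the trace exponential of a sum of
independent centred matrices into a supermartingale. -/
theorem integral_trace_exp_compensated_le (hmeas : ∀ i, Measurable (M i)) (hindep : iIndepFun M P)
    (hsymm : ∀ i, ∀ᵐ ω ∂P, (M i ω).IsSymm) (hmean : ∀ i α β, ∫ ω, M i ω α β ∂P = 0)
    (hbound : ∀ i, ∀ᵐ ω ∂P, ‖M i ω‖ ≤ R) {η : ℝ} (hη : 0 ≤ η) (hηR : η * R ≤ 3 / 2)
    (s : Finset (Fin k)) :
    ∫ ω, (exp (η • ∑ i ∈ s, M i ω - η ^ 2 • ∑ i ∈ s, secondMoment P (M i))).trace ∂P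
      ≤ Fintype.card n := by
  classical
  induction s using Finset.induction_on with
  | empty => simp
  | insert a s ha ih =>
    -- The summand `M a` and its compensator `W` are removed together.
    refine le_trans ?_ ih
    set V := η ^ 2 • ∑ i ∈ s, secondMoment P (M i)
    set W := η ^ 2 • secondMoment P (M a)
    have hW : W.IsSymm := (isSymm_secondMoment (hsymm a)).smul _
    have hV : V.IsSymm := by
      refine IsSymm.smul ?_ _
      rw [IsSymm, transpose_sum]
      exact Finset.sum_congr rfl fun i _ => isSymm_secondMoment (hsymm i)
    have hS : Measurable fun ω => ∑ i ∈ s, M i ω := Finset.measurable_fun_sum s fun i _ => hmeas i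
    have hSb := ae_norm_sum_le hbound s
    have hSs : ∀ᵐ ω ∂P, (∑ i ∈ s, M i ω).IsSymm := by
      filter_upwards [ae_all_iff.2 hsymm] with ω hω
      rw [IsSymm, transpose_sum]
      exact Finset.sum_congr rfl fun i _ => hω i
    have hind : IndepFun (fun ω => ∑ i ∈ s, M i ω) (M a) P := by
      have := hindep.indepFun_finsetSum_of_notMem hmeas ha
      convert this using 1
      ext ω : 1
      simp
    have hcG : Continuous fun S : Matrix n n ℝ => exp (η • S - V - W) :=
      continuous_matrix_exp.comp (by fun_prop)
    have hcH : Continuous fun Y : Matrix n n ℝ => 1 + η • Y + (η • Y) ^ 2 := by fun_prop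
    have hG : ∀ α β, Integrable (fun ω => exp (η • ∑ i ∈ s, M i ω - V - W) α β) P := fun α β =>
      integrable_comp_of_norm_le (hcG.matrix_elem α β) hS hSb
    have hH : ∀ α β, Integrable (fun ω => (1 + η • M a ω + (η • M a ω) ^ 2 : Matrix n n ℝ) α β) P :=
      fun α β => integrable_comp_of_norm_le (hcH.matrix_elem α β) (hmeas a) (hbound a)
    have hGH : ∀ α β, IndepFun (fun ω => exp (η • ∑ i ∈ s, M i ω - V - W) α β)
        (fun ω => (1 + η • M a ω + (η • M a ω) ^ 2 : Matrix n n ℝ) β α) P := fun α β =>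
      hind.comp (hcG.matrix_elem α β).measurable (hcH.matrix_elem β α).measurable
    have hGHi : ∀ α β, Integrable (fun ω => exp (η • ∑ i ∈ s, M i ω - V - W) α β
        * (1 + η • M a ω + (η • M a ω) ^ 2 : Matrix n n ℝ) β α) P := fun α β =>
      (hGH α β).integrable_mul (hG α β) (hH β α)
    -- The linear term averages to zero and the quadratic one to `W`.
    have hHint : ∀ α β, ∫ ω, (1 + η • M a ω + (η • M a ω) ^ 2 : Matrix n n ℝ) α β ∂P
        = (1 + W) α β := fun α β => by
      have h1 : Integrable (fun ω => M a ω α β) P := integrable_comp_of_norm_le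
        (f := fun Y => Y α β) (by fun_prop) (hmeas a) (hbound a)
      have h2 : Integrable (fun ω => (M a ω ^ 2) α β) P := integrable_comp_of_norm_le
        (f := fun Y => (Y ^ 2) α β) ((continuous_pow 2).matrix_elem α β) (hmeas a) (hbound a)
      simp only [smul_pow, Matrix.add_apply, Matrix.smul_apply, smul_eq_mul]
      have h3 : Integrable (fun ω => (1 : Matrix n n ℝ) α β + η * M a ω α β) P :=
        (integrable_const _).add (h1.const_mul _)
      rw [integral_add h3 (h2.const_mul _),
        integral_add (integrable_const _) (h1.const_mul _), integral_const_mul, integral_const_mul,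
        hmean]
      simp [W, secondMoment]
    calc ∫ ω, (exp (η • ∑ i ∈ insert a s, M i ω
            - η ^ 2 • ∑ i ∈ insert a s, secondMoment P (M i))).trace ∂P
        ≤ ∫ ω, (exp (η • ∑ i ∈ s, M i ω - V - W)
            * (1 + η • M a ω + (η • M a ω) ^ 2)).trace ∂P := by
          refine integral_mono_ae ?_ ?_ ?_
          · exact integrable_comp_of_norm_le
              (f := fun S => (exp (η • S - η ^ 2 • ∑ i ∈ insert a s, secondMoment P (M i))).trace)
              (continuous_matrix_exp.comp (by fun_prop)).matrix_trace
              (Finset.measurable_fun_sum _ fun i _ => hmeas i) (ae_norm_sum_le hbound _)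
          · simp only [Matrix.trace, Matrix.diag_apply, Matrix.mul_apply]
            exact integrable_finsetSum _ fun α _ => integrable_finsetSum _ fun β _ =>
              hGHi α β
          · filter_upwards [hSs, hsymm a, hbound a] with ω h1 h2 h3
            have h4 : η • ∑ i ∈ insert a s, M i ω - η ^ 2 • ∑ i ∈ insert a s, secondMoment P (M i)
                = (η • ∑ i ∈ s, M i ω - V - W) + η • M a ω := by
              rw [Finset.sum_insert ha, Finset.sum_insert ha, smul_add, smul_add]
              simp only [V, W]
              abel
            simp only [h4]
            refine trace_exp_add_le_of_norm_le (((h1.smul η).sub hV).sub hW) (h2.smul η) ?_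
            rw [norm_smul, Real.norm_of_nonneg hη]
            exact (mul_le_mul_of_nonneg_left h3 hη).trans hηR
      -- Independence, entry by entry, replaces the second factor by its mean.
      _ = ∫ ω, (exp (η • ∑ i ∈ s, M i ω - V - W) * (1 + W)).trace ∂P := by
          simp only [Matrix.trace, Matrix.diag_apply, Matrix.mul_apply]
          rw [integral_finsetSum _ fun α _ => integrable_finsetSum _ fun β _ =>
              hGHi α β,
            integral_finsetSum _ fun α _ => integrable_finsetSum _ fun β _ =>
              (hG α β).mul_const _]
          refine Finset.sum_congr rfl fun α _ => ?_
          rw [integral_finsetSum _ fun β _ => hGHi α β,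
            integral_finsetSum _ fun β _ => (hG α β).mul_const _]
          refine Finset.sum_congr rfl fun β _ => ?_
          rw [(hGH α β).integral_fun_mul_eq_mul_integral (hG α β).1 (hH β α).1, hHint,
            integral_mul_const]
      _ ≤ ∫ ω, (exp (η • ∑ i ∈ s, M i ω - V)).trace ∂P := by
          refine integral_mono_ae ?_ ?_ ?_
          · exact integrable_comp_of_norm_le
              (f := fun S => (exp (η • S - V - W) * (1 + W)).trace)
              (hcG.mul continuous_const).matrix_trace hS hSb
          · exact integrable_comp_of_norm_le (f := fun S => (exp (η • S - V)).trace)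
              (continuous_matrix_exp.comp (by fun_prop)).matrix_trace hS hSb
          · filter_upwards [hSs] with ω h1
            have := trace_exp_mul_one_add_le (((h1.smul η).sub hV).sub hW) hW
            rwa [sub_add_cancel] at this

end Probability

/-! ### Choice of the parameter and conclusion -/

section Main
open MeasureTheory ProbabilityTheory
open scoped Matrix.Norms.L2Operator
open NormedSpace (exp)

theorem le_of_forall_le_div_add_mul {x L R s : ℝ} (hL : 0 < L) (hR : 0 ≤ R) (hs : 0 ≤ s)
    (h : ∀ η : ℝ, 0 < η → η * R ≤ 3 / 2 → x ≤ L / η + s ^ 2 * η) :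
    x ≤ 2 * L / 3 * R + 2 * (s * Real.sqrt L) := by
  refine le_of_forall_pos_le_add fun ε hε => ?_
  have hq : 0 < Real.sqrt L := Real.sqrt_pos.2 hL
  have hqq : Real.sqrt L * Real.sqrt L = L := Real.mul_self_sqrt hL.le
  -- b is 1/η: the first term enforces ηR ≤ 3/2, the second is the unconstrained optimum of L/η +
  -- s²η, and the third keeps b positive when R = s = 0.
  set b := 2 / 3 * R + s / Real.sqrt L + ε / L with hb
  have h0 : 0 ≤ s / Real.sqrt L := by positivity
  have h0' : 0 < ε / L := by positivity
  have hb0 : 0 < b := by positivity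
  have h1 := h b⁻¹ (inv_pos.2 hb0) (by
    rw [inv_mul_le_iff₀ hb0]; linarith)
  have h2 : L / b⁻¹ = 2 * L / 3 * R + s * Real.sqrt L + ε := by
    rw [div_inv_eq_mul, hb]
    have : L * (s / Real.sqrt L) = s * Real.sqrt L := by
      field_simp; rw [sq, hqq, mul_comm]
    rw [mul_add, mul_add, this]; field_simp
  have h3 : s ^ 2 * b⁻¹ ≤ s * Real.sqrt L := by
    rw [← div_eq_mul_inv, div_le_iff₀ hb0]
    have : s / Real.sqrt L ≤ b := by linarith [mul_nonneg (by norm_num : (0 : ℝ) ≤ 2 / 3) hR]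
    rw [div_le_iff₀ hq] at this
    nlinarith [mul_le_mul_of_nonneg_left this hs]
  linarith

end Main

end

theorem mainTheorem4 {Ω : Type*} [MeasurableSpace Ω] (P : MeasureTheory.Measure Ω)
    [MeasureTheory.IsProbabilityMeasure P]
    (d r k : ℕ) (hd : 1 ≤ d) (R σ : ℝ) (hR : 0 ≤ R) (hσ : 0 ≤ σ)
    (M : Fin k → Ω → Matrix (Fin r → Fin d) (Fin r → Fin d) ℝ)
    (hmeas : ∀ i, Measurable (M i))
    (hindep : ProbabilityTheory.iIndepFun M P)
    (hident : ∀ i j, ProbabilityTheory.IdentDistrib (M i) (M j) P P)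
    (hsymm : ∀ i, ∀ᵐ ω ∂P, (M i ω).IsSymm)
    (hmean : ∀ i α β, ∫ ω, M i ω α β ∂P = 0)
    (hbound : ∀ i, ∀ᵐ ω ∂P, ‖Matrix.toEuclideanCLM (𝕜 := ℝ) (M i ω)‖ ≤ R)
    (hvar : ∀ i, SosLE
      (fun u : Fin d → ℝ => ∫ ω, tensorPow r u ⬝ᵥ (Matrix.mulVec (M i ω ^ 2) (tensorPow r u)) ∂P)
      (fun u : Fin d → ℝ => σ ^ 2 * ‖WithLp.toLp 2 u‖ ^ (2 * r))) :
    (∀ ω, IsGreatest (sosValues (∑ i, tensorForm (M i ω))) (sosMax (∑ i, tensorForm (M i ω)))) ∧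
    MeasureTheory.Integrable (fun ω => sosMax (∑ i, tensorForm (M i ω))) P ∧
    ∫ ω, sosMax (∑ i, tensorForm (M i ω)) ∂P ≤
      2 * (Real.log 2 + r * Real.log d) / 3 * R
        + 2 * Real.sqrt (2 * k * (Real.log 2 + r * Real.log d)) * σ := by
  open MeasureTheory Matrix Matrix.Norms.L2Operator in
  have hne : Nonempty (Fin r → Fin d) := ⟨fun _ => ⟨0, hd⟩⟩
  have hbound' : ∀ i, ∀ᵐ ω ∂P, ‖M i ω‖ ≤ R := hbound
  have hS : Measurable fun ω => ∑ i, M i ω := Finset.measurable_fun_sum _ fun i _ => hmeas i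
  have hSb := ae_norm_sum_le hbound' Finset.univ
  have hint : Integrable (fun ω => sosMax (∑ i, tensorForm (M i ω))) P := by
    simp only [sum_tensorForm]
    exact integrable_comp_of_norm_le (continuous_sosMax_tensorForm hd) hS hSb
  refine ⟨fun ω => isGreatest_sosMax hd _, hint, ?_⟩
  -- Expectation passes inside the quadratic form, so the hypothesis concerns the second-moment
  -- matrix.
  have hV : ∀ i, SosLE (fun u : Fin d → ℝ =>
      tensorPow r u ⬝ᵥ (secondMoment P (M i) *ᵥ tensorPow r u))
      (fun u : Fin d → ℝ => σ ^ 2 * ‖WithLp.toLp 2 u‖ ^ (2 * r)) := fun i => by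
    convert hvar i using 2 with u
    have h2 : ∀ α β, Integrable (fun ω => (M i ω ^ 2) α β) P := fun α β =>
      integrable_comp_of_norm_le (f := fun Y => (Y ^ 2) α β)
        ((continuous_pow 2).matrix_elem α β) (hmeas i) (hbound' i)
    simp only [dotProduct, mulVec]
    rw [integral_finsetSum _ fun α _ =>
      (integrable_finsetSum _ fun β _ => (h2 α β).mul_const _).const_mul _]
    refine Finset.sum_congr rfl fun α _ => ?_
    rw [integral_const_mul, integral_finsetSum _ fun β _ => (h2 α β).mul_const _]
    congr 1
    refine Finset.sum_congr rfl fun β _ => ?_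
    rw [integral_mul_const]
    rfl
  have hlogd : 0 ≤ r * Real.log d := mul_nonneg (Nat.cast_nonneg _) (Real.log_natCast_nonneg d)
  -- The log 2 keeps this positive even if d = 1 or r = 0.
  have hL : 0 < Real.log 2 + r * Real.log d :=
    add_pos_of_pos_of_nonneg (Real.log_pos one_lt_two) hlogd
  have hkey : ∫ ω, sosMax (∑ i, tensorForm (M i ω)) ∂P ≤
      2 * (Real.log 2 + r * Real.log d) / 3 * R
        + 2 * ((Real.sqrt k * σ) * Real.sqrt (Real.log 2 + r * Real.log d)) := by
    refine le_of_forall_le_div_add_mul hL hR (by positivity) fun η hη hηR => ?_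
    set V := ∑ i, secondMoment P (M i)
    set N : ℝ := (Fintype.card (Fin r → Fin d) : ℝ) with hN
    have hN0 : 0 < N := by rw [hN]; exact_mod_cast Fintype.card_pos
    have hlogN : Real.log N = r * Real.log d := by
      rw [hN]; simp
    have hVs : V.IsSymm := by
      rw [IsSymm, transpose_sum]
      exact Finset.sum_congr rfl fun i _ => isSymm_secondMoment (hsymm i)
    have hZint : Integrable (fun ω =>
        (NormedSpace.exp (η • ∑ i, M i ω - η ^ 2 • V)).trace) P :=
      integrable_comp_of_norm_le (f := fun S => (NormedSpace.exp (η • S - η ^ 2 • V)).trace)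
        (continuous_matrix_exp.comp (by fun_prop)).matrix_trace hS hSb
    have hZ := integral_trace_exp_compensated_le hmeas hindep hsymm hmean hbound' hη.le hηR
      Finset.univ
    have hpt : ∀ᵐ ω ∂P, sosMax (∑ i, tensorForm (M i ω)) ≤
        (Real.log N - 1) / η + k * σ ^ 2 * η
          + (η * N)⁻¹ * (NormedSpace.exp (η • ∑ i, M i ω - η ^ 2 • V)).trace := by
      filter_upwards [ae_all_iff.2 hsymm] with ω hω
      have hSs : (∑ i, M i ω).IsSymm := by
        rw [IsSymm, transpose_sum]
        exact Finset.sum_congr rfl fun i _ => hω i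
      have hCs := (hSs.smul η).sub (hVs.smul (η ^ 2))
      rw [sum_tensorForm]
      obtain ⟨F, hF, h⟩ := exists_isSphereFunctional_eq_sosMax hd (∑ i, M i ω)
      rw [← h]
      have h1 := hF.map_tensorFormPoly_le_log_trace_exp hCs
      have h2 : F (tensorFormPoly V) ≤ k * σ ^ 2 := by
        have : F (tensorFormPoly V) = ∑ i, F (tensorFormPoly (secondMoment P (M i))) := by
          have := congrArg (fun p => F p.1) (sum_tensorForm fun i => secondMoment P (M i))
          simp only [AddSubmonoidClass.coe_finsetSum, map_sum] at this
          exact this.symm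
        rw [this]
        refine (Finset.sum_le_sum fun i _ => hF.map_tensorFormPoly_le_of_sosLE (hV i)).trans_eq ?_
        simp
      have h3 : F (tensorFormPoly (η • ∑ i, M i ω - η ^ 2 • V))
          = η * F (tensorFormPoly (∑ i, M i ω)) - η ^ 2 * F (tensorFormPoly V) := by
        simp only [F.map_tensorFormPoly, Finset.mul_sum, ← Finset.sum_sub_distrib]
        refine Finset.sum_congr rfl fun α _ => Finset.sum_congr rfl fun β _ => ?_
        simp only [Matrix.sub_apply, Matrix.smul_apply, smul_eq_mul]
        ring
      rw [h3] at h1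
      have hZ0 := trace_exp_pos hCs
      -- The tangent to log at N stands in for Jensen: the pointwise bound becomes affine in Z and
      -- can be integrated directly.
      have h4 := Real.log_le_sub_one_of_pos (div_pos hZ0 hN0)
      rw [Real.log_div hZ0.ne' hN0.ne'] at h4
      have h5 := mul_le_mul_of_nonneg_left h2 (sq_nonneg η)
      set Z := (NormedSpace.exp (η • ∑ i, M i ω - η ^ 2 • V)).trace
      have h6 : (Real.log N - 1) / η + k * σ ^ 2 * η + (η * N)⁻¹ * Z
          = (Real.log N - 1 + η ^ 2 * (k * σ ^ 2) + Z / N) / η := by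
        field_simp
      rw [h6, le_div_iff₀ hη]
      linarith
    calc ∫ ω, sosMax (∑ i, tensorForm (M i ω)) ∂P
        ≤ ∫ ω, ((Real.log N - 1) / η + k * σ ^ 2 * η
          + (η * N)⁻¹ * (NormedSpace.exp (η • ∑ i, M i ω - η ^ 2 • V)).trace) ∂P :=
          integral_mono_ae hint ((integrable_const _).add (hZint.const_mul _)) hpt
      _ = (Real.log N - 1) / η + k * σ ^ 2 * η + (η * N)⁻¹
          * ∫ ω, (NormedSpace.exp (η • ∑ i, M i ω - η ^ 2 • V)).trace ∂P := by
          rw [integral_add (integrable_const _) (hZint.const_mul _), integral_const_mul]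
          simp
      _ ≤ (Real.log N - 1) / η + k * σ ^ 2 * η + (η * N)⁻¹ * N := by
          gcongr
      _ = Real.log N / η + k * σ ^ 2 * η := by field_simp; ring
      _ ≤ (Real.log 2 + r * Real.log d) / η + (Real.sqrt k * σ) ^ 2 * η := by
          rw [mul_pow, Real.sq_sqrt (Nat.cast_nonneg k), hlogN]
          have := (Real.log_pos one_lt_two).le
          gcongr
          linarith
  -- The bound obtained is stronger by a factor √2 in the σ term.
  refine hkey.trans (add_le_add_right ?_ _)
  rw [mul_assoc (2 : ℝ) (k : ℝ), Real.sqrt_mul (by norm_num : (0 : ℝ) ≤ 2),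
    Real.sqrt_mul (Nat.cast_nonneg k)]
  have h1 : 1 ≤ Real.sqrt 2 := Real.one_le_sqrt.2 one_le_two
  have h2 : 0 ≤ Real.sqrt k * Real.sqrt (Real.log 2 + r * Real.log d) * σ := by positivity
  nlinarith
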